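/- Let $p_1,\dots,p_n$ be points of the hyperboloid model $\mathbb{M}_m=\{x\in\mathbb{R}^{m+1}: x_0^2-\sum_{k\ge1}x_k^2=1,\ x_0>0\}$ with distance $d_H(x,y)=\operatorname{acosh}\bigl(x_0y_0-\sum_{k\ge1}x_ky_k\bigr)$, not all equal, and let $r$ be the dimension of the geodesic submanifold they span (that is, their linear span in $\mathbb{R}^{m+1}$ has dimension $r+1$). Let $H\in\mathbb{R}^{n\times n}$ be the distance matrix, $H_{i,j}=d_H(p_i,p_j)$. For a symmetric matrix $G\in\mathbb{R}^{n\times n}$, a (rank-$r$) h-MDS configuration of $G$ is a matrix $X\in\mathbb{R}^{n\times r}$, whose rows are the recovered points, obtained by rank-$r$ PCA of the matrix $-\bigl(\cosh G_{i,j}\bigr)_{i,j}$: for some orthogonal diagonalization $V\operatorname{diag}(\mu_1,\dots,\mu_n)V^T$ of this matrix with $\mu_1\ge\dots\ge\mu_n$, the $j$-th column of $X$ is $\sqrt{\max(\mu_j,0)}$ times the $j$-th column of $V$, $1\le j\le r$. Its Poincaré projection $Z$ is obtained by replacing each row $x$ of $X$ by $x/(1+\sqrt{1+\|x\|_2^2})$.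 For $X,Y\in\mathbb{R}^{n\times r}$ put $D(X,Y)=\operatorname{tr}\bigl((X-Y)^T(X-Y)\bigr)$ and $$D_E(X,Y)=\inf\{D(X,YP^T): P\in\mathbb{R}^{r\times r},\ P^TP=I\},$$ and let $\|A\|_\infty=\max_{i,j}|A_{i,j}|$. Then, to second order in a symmetric perturbation $\Delta(H)$ of $H$, the orthogonal-alignment gap is at most $\frac{2n^2}{\lambda_{\min}}\sinh^2(\|H\|_\infty)\|\Delta(H)\|_\infty^2$. Precisely: there are constants $C$ and $\varepsilon>0$, depending only on $p_1,\dots,p_n$, such that for every symmetric $\Delta(H)\in\mathbb{R}^{n\times n}$ with $\|\Delta(H)\|_\infty\le\varepsilon$, every h-MDS configuration $X$ of $H$ and every h-MDS configuration $\hat X$ of $H+\Delta(H)$, both of rank $r$, $$D_E(X,\hat X)\le\frac{2n^2}{\lambda_{\min}}\sinh^2\bigl(\|H\|_\infty\bigr)\,\|\Delta(H)\|_\infty^2+C\,\|\Delta(H)\|_\infty^3,$$ where $\lambda_{\min}$ is the smallest nonzero eigenvalue of $XX^T$. The same bound holds for the Poincaré projections $Z,\hat Z$ of $X,\hat X$: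 $$D_E(Z,\hat Z)\le\frac{2n^2}{\lambda_{\min}}\sinh^2\bigl(\|H\|_\infty\bigr)\,\|\Delta(H)\|_\infty^2+C\,\|\Delta(H)\|_\infty^3.$$ -/

import Mathlib

open scoped Matrix

noncomputable section

namespace HMDS

/-- The hyperboloid model `𝕄_m` of `m`-dimensional hyperbolic space: the upper sheet of
`x₀² - x₁² - ⋯ - x_m² = 1` in `ℝ^{m+1}`. -/
def Hyperboloid (m : ℕ) : Type :=
  {x : Fin (m + 1) → ℝ // x 0 ^ 2 - ∑ k : Fin m, x k.succ ^ 2 = 1 ∧ 0 < x 0}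

/-- The Lorentzian form `x₀ y₀ - x₁ y₁ - ⋯ - x_m y_m`. -/
def lorentz {m : ℕ} (x y : Fin (m + 1) → ℝ) : ℝ :=
  x 0 * y 0 - ∑ k : Fin m, x k.succ * y k.succ

/-- The hyperbolic distance `acosh (x₀ y₀ - x₁ y₁ - ⋯ - x_m y_m)`. -/
def hypDist {m : ℕ} (x y : Hyperboloid m) : ℝ :=
  Real.arcosh (lorentz x.1 y.1)

/-- The matrix of pairwise hyperbolic distances of a finite family of points. -/
def distMatrix {m n : ℕ} (p : Fin n → Hyperboloid m) : Matrix (Fin n) (Fin n) ℝ :=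
  Matrix.of fun i j => hypDist (p i) (p j)

/-- `p` spans an `r`-dimensional geodesic submanifold: the linear span of the points in `ℝ^{m+1}`
has dimension `r + 1` (geodesic submanifolds of the hyperboloid are its intersections with linear
subspaces, an `r`-dimensional one coming from an `(r + 1)`-dimensional subspace). -/
def SpansGeodesicDim {m n : ℕ} (p : Fin n → Hyperboloid m) (r : ℕ) : Prop :=
  Module.finrank ℝ (Submodule.span ℝ (Set.range fun i => (p i).1)) = r + 1

/-- `X` is an output of rank-`r` PCA on the symmetric matrix `A`: for some orthogonal
diagonalization `A = V diag(μ) Vᵀ` with `μ₁ ≥ μ₂ ≥ ⋯ ≥ μ_n`, the `j`-th column of `X` is `√μ_j`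
times the `j`-th column of `V`, for `j = 1, …, r` (a negative `μ_j` is truncated to `0`). -/
def IsPCA {n r : ℕ} (A : Matrix (Fin n) (Fin n) ℝ) (X : Matrix (Fin n) (Fin r) ℝ) : Prop :=
  ∃ (h : r ≤ n) (V : Matrix (Fin n) (Fin n) ℝ) (μ : Fin n → ℝ),
    Vᵀ * V = 1 ∧ Antitone μ ∧ A = V * Matrix.diagonal μ * Vᵀ ∧
    ∀ (i : Fin n) (j : Fin r), X i j = √(μ (Fin.castLE h j)) * V i (Fin.castLE h j)

/-- `X` (rows are points) is a rank-`r` h-MDS configuration of the distance matrix `H`: it is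
obtained by rank-`r` PCA on `-Y`, where `Y i j = cosh (H i j)`. The row `x` stands for the point
`(√(1 + ‖x‖²), x)` of the hyperboloid. -/
def IsHMDS {n r : ℕ} (H : Matrix (Fin n) (Fin n) ℝ) (X : Matrix (Fin n) (Fin r) ℝ) : Prop :=
  IsPCA (-(H.map Real.cosh)) X

/-- The projection of a configuration to the Poincaré ball: every row `x` is replaced by
`x / (1 + √(1 + ‖x‖²))`. -/
def poincare {n r : ℕ} (X : Matrix (Fin n) (Fin r) ℝ) : Matrix (Fin n) (Fin r) ℝ :=
  Matrix.of fun i j => X i j / (1 + √(1 + ∑ k, X i k ^ 2))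

/-- The gap `D(X, Y) = tr((X - Y)ᵀ (X - Y))`. -/
def gap {n r : ℕ} (X Y : Matrix (Fin n) (Fin r) ℝ) : ℝ :=
  ((X - Y)ᵀ * (X - Y)).trace

/-- The gap up to orthogonal alignment, `D_E(X, Y)`: the infimum of `D` between `X` and the
configuration whose points (rows) are the images of those of `Y` under an orthogonal `P`. -/
def alignedGap {n r : ℕ} (X Y : Matrix (Fin n) (Fin r) ℝ) : ℝ :=
  sInf {d : ℝ | ∃ P : Matrix (Fin r) (Fin r) ℝ, Pᵀ * P = 1 ∧ d = gap X (Y * Pᵀ)}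

/-- The entrywise maximum norm `max |A i j|` (the sup norm of the family of entries). -/
def maxNorm {n : ℕ} (A : Matrix (Fin n) (Fin n) ℝ) : ℝ :=
  ‖(fun i j => A i j : Fin n → Fin n → ℝ)‖

/-- `lam` is the smallest nonzero eigenvalue of `A`. -/
def IsMinNonzeroEigenvalue {n : ℕ} (A : Matrix (Fin n) (Fin n) ℝ) (lam : ℝ) : Prop :=
  IsLeast {μ : ℝ | μ ≠ 0 ∧ Module.End.HasEigenvalue (Matrix.toLin' A) μ} lam

end HMDS

end

/-! Put `A = -cosh H`. As a quadratic form, `A` is minus the Lorentz form pulled back along `v ↦ ∑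
vᵢ pᵢ`. The span of the points contains a timelike vector and has dimension `r + 1`, so `A` has
exactly `r` positive eigenvalues. Rank-`r` PCA therefore loses nothing of the positive part: `X Xᵀ =
A₊`, with nonzero eigenvalues at least `λ`.

Perturbing `H` by entries of size at most `d` changes `A` by `E` with `‖E‖_F ≤ e = n (sinh ‖H‖ d +
O(d²))`. Two estimates carry the bound. First, truncated positive parts are almost nonexpansive: `(1
- 2e/λ) ‖X̂X̂ᵀ - XXᵀ‖² ≤ ‖E‖²` (`IsPCA.trace_sq_sub_le`). Taking positive parts is a contraction,
and the eigenvalues cut off after index `r` are at most `e` by Weyl. Second, if `X̂` is rotated by a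
polar decomposition so that `Xᵀ X̂ Pᵀ ⪰ 0`, then `(2/3) λ · gap ≤ ‖X̂X̂ᵀ - XXᵀ‖²`
(`exists_orthogonal_gap_le`). For `e ≤ λ/8` the constants combine to `(3/2)(4/3) = 2`.

The Poincaré projection is 1-Lipschitz and commutes with rotations, so the same `P` gives the second
bound. -/

namespace HMDS

/-! ### Quadratic forms, Frobenius norm and Weyl's bound -/

/-- The quadratic form of an orthogonally diagonalized matrix, in the eigenbasis. -/
theorem dotProduct_diagonalization_mulVec {n : ℕ} (V : Matrix (Fin n) (Fin n) ℝ) (μ v : Fin n → ℝ) :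
    v ⬝ᵥ (V * Matrix.diagonal μ * Vᵀ) *ᵥ v = ∑ i, μ i * (Vᵀ *ᵥ v) i ^ 2 := by
  rw [← Matrix.mulVec_mulVec, ← Matrix.mulVec_mulVec, Matrix.dotProduct_mulVec,
    ← Matrix.mulVec_transpose]
  simp only [dotProduct, Matrix.mulVec_diagonal]
  exact Finset.sum_congr rfl fun i _ => by ring

theorem sum_transpose_mulVec_sq {n : ℕ} {V : Matrix (Fin n) (Fin n) ℝ} (hV : Vᵀ * V = 1)
    (v : Fin n → ℝ) : ∑ i, (Vᵀ *ᵥ v) i ^ 2 = ∑ i, v i ^ 2 := by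
  have h := dotProduct_diagonalization_mulVec V (fun _ => 1) v
  rw [Matrix.diagonal_one, Matrix.mul_one, mul_eq_one_comm.1 hV] at h
  simp only [Matrix.one_mulVec, one_mul, dotProduct] at h
  rw [← h]
  exact Finset.sum_congr rfl fun i _ => by ring

/-- A subspace and a coordinate subspace whose dimensions add up to more than `n` meet. -/
theorem exists_mem_ne_zero_forall_notMem {n : ℕ} (V : Matrix (Fin n) (Fin n) ℝ)
    (S : Submodule ℝ (Fin n → ℝ)) (s : Finset (Fin n)) (h : n < Module.finrank ℝ S + s.card) :
    ∃ v ∈ S, v ≠ 0 ∧ ∀ i ∉ s, (Vᵀ *ᵥ v) i = 0 := by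
  let f : S →ₗ[ℝ] ({i // i ∉ s} → ℝ) :=
    (LinearMap.funLeft ℝ ℝ (Subtype.val : {i // i ∉ s} → Fin n)) ∘ₗ Matrix.toLin' Vᵀ ∘ₗ S.subtype
  have hf : LinearMap.ker f ≠ ⊥ := by
    apply LinearMap.ker_ne_bot_of_finrank_lt
    have hc : Fintype.card {i // i ∉ s} = n - s.card := by
      rw [Fintype.card_subtype_compl]; simp
    rw [Module.finrank_fintype_fun_eq_card, hc]
    have := s.card_le_univ
    simp only [Fintype.card_fin] at this
    omega
  obtain ⟨x, hx, hx0⟩ := (Submodule.ne_bot_iff _).1 hf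
  refine ⟨x, x.2, by simpa using hx0, fun i hi => ?_⟩
  have := congrFun (LinearMap.mem_ker.1 hx) ⟨i, hi⟩
  simpa [f, LinearMap.funLeft] using this

/-- The quadratic form of a matrix is bounded by its Frobenius norm. -/
theorem abs_dotProduct_mulVec_le {n : ℕ} {E : Matrix (Fin n) (Fin n) ℝ} {e : ℝ} (he : 0 ≤ e)
    (hE : ∑ i, ∑ j, E i j ^ 2 ≤ e ^ 2) (v : Fin n → ℝ) :
    |v ⬝ᵥ E *ᵥ v| ≤ e * ∑ i, v i ^ 2 := by
  have h0 : 0 ≤ ∑ i, v i ^ 2 := Finset.sum_nonneg fun i _ => sq_nonneg _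
  refine abs_le_of_sq_le_sq ?_ (by positivity)
  have h1 : v ⬝ᵥ E *ᵥ v = ∑ x : Fin n × Fin n, E x.1 x.2 * (v x.1 * v x.2) := by
    rw [Fintype.sum_prod_type]
    simp only [dotProduct, Matrix.mulVec, Finset.mul_sum]
    exact Finset.sum_congr rfl fun i _ => Finset.sum_congr rfl fun j _ => by ring
  have h2 := Finset.sum_mul_sq_le_sq_mul_sq Finset.univ
    (fun x : Fin n × Fin n => E x.1 x.2) (fun x => v x.1 * v x.2)
  rw [h1]
  refine h2.trans ?_
  rw [Fintype.sum_prod_type, Fintype.sum_prod_type]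
  have h3 : ∑ i, ∑ j, (v i * v j) ^ 2 = (∑ i, v i ^ 2) ^ 2 := by
    rw [sq (∑ i, v i ^ 2), Finset.sum_mul_sum]
    exact Finset.sum_congr rfl fun i _ => Finset.sum_congr rfl fun j _ => by ring
  simp only at h3 ⊢
  rw [h3, mul_pow]
  gcongr

theorem trace_transpose_mul_self {l k : Type*} [Fintype l] [Fintype k] (E : Matrix l k ℝ) :
    (Eᵀ * E).trace = ∑ i, ∑ j, E i j ^ 2 := by
  simp only [Matrix.trace, Matrix.diag_apply, Matrix.mul_apply, Matrix.transpose_apply]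
  rw [Finset.sum_comm]
  exact Finset.sum_congr rfl fun i _ => Finset.sum_congr rfl fun j _ => by ring

/-- Weyl's bound: a perturbation `E` of a matrix that is negative semidefinite on a subspace of
codimension at most `r` has all but `r` eigenvalues at most `‖E‖`. -/
theorem eigenvalue_le_of_forall_mem_ker {n r : ℕ} {A E V : Matrix (Fin n) (Fin n) ℝ}
    {X : Matrix (Fin n) (Fin r) ℝ} {μ : Fin n → ℝ} {e : ℝ}
    (hA : ∀ v, Xᵀ *ᵥ v = 0 → v ⬝ᵥ A *ᵥ v ≤ 0) (he : 0 ≤ e) (hE : ∑ i, ∑ j, E i j ^ 2 ≤ e ^ 2)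
    (hV : Vᵀ * V = 1) (hμ : Antitone μ) (hd : A + E = V * Matrix.diagonal μ * Vᵀ)
    {j : Fin n} (hj : r ≤ j) : μ j ≤ e := by
  -- The kernel has dimension at least `n - r` and `Iic j` has `j + 1 ≥ r + 1` elements, so the two
  -- spaces meet.
  obtain ⟨v, hv, hv0, hvs⟩ := exists_mem_ne_zero_forall_notMem V
    (LinearMap.ker (Matrix.toLin' Xᵀ)) (Finset.Iic j) (by
      have h1 := LinearMap.finrank_range_add_finrank_ker (Matrix.toLin' Xᵀ)
      have h2 := (LinearMap.range (Matrix.toLin' Xᵀ)).finrank_le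
      rw [Module.finrank_fin_fun] at h1 h2
      rw [Fin.card_Iic]
      omega)
  have h1 := dotProduct_diagonalization_mulVec V μ v
  have h2 := sum_transpose_mulVec_sq hV v
  have h3 := (abs_le.1 (abs_dotProduct_mulVec_le he hE v)).2
  have h4 := hA v (by simpa using hv)
  rw [← hd, Matrix.add_mulVec, dotProduct_add] at h1
  have hpos : 0 < ∑ i, v i ^ 2 := by
    obtain ⟨i, hi⟩ := Function.ne_iff.1 hv0
    exact Finset.sum_pos' (fun i _ => sq_nonneg _) ⟨i, Finset.mem_univ _, by
      simpa using sq_pos_of_ne_zero hi⟩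
  have h5 : μ j * ∑ i, v i ^ 2 ≤ ∑ i, μ i * (Vᵀ *ᵥ v) i ^ 2 := by
    rw [← h2, Finset.mul_sum]
    refine Finset.sum_le_sum fun i _ => ?_
    by_cases hi : i ∈ Finset.Iic j
    · exact mul_le_mul_of_nonneg_right (hμ (Finset.mem_Iic.1 hi)) (sq_nonneg _)
    · simp [hvs i hi]
  refine le_of_mul_le_mul_right ?_ hpos
  linarith

/-! ### Stability of the positive part -/

/-- Stability of the positive part, in the eigenbasis `diag (b + ρ)` of the perturbed matrix. -/
theorem trace_sq_diagonal_sub_le {n : ℕ} {Y N : Matrix (Fin n) (Fin n) ℝ} {b ρ : Fin n → ℝ}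
    {lam e : ℝ} (hlam : 0 < lam) (he : 0 ≤ e) (hY : Y.PosSemidef)
    (hYY : (Y * Y - lam • Y).PosSemidef) (hN : N.PosSemidef) (hYN : (Y * N).trace = 0)
    (hb : ∀ j, 0 ≤ b j) (hbρ : ∀ j, b j * ρ j = 0) (hρ : ∀ j, ρ j ≤ e) :
    (1 - 2 * e / lam) * ((Matrix.diagonal b - Y)ᵀ * (Matrix.diagonal b - Y)).trace ≤
      ((Matrix.diagonal (b + ρ) - (Y - N))ᵀ * (Matrix.diagonal (b + ρ) - (Y - N))).trace := by
  have hYt : Yᵀ = Y := hY.1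
  have hNt : Nᵀ = N := hN.1
  set M := Matrix.diagonal b - Y with hM
  set R := Matrix.diagonal ρ + N with hR
  have hMt : Mᵀ = M := by rw [hM, Matrix.transpose_sub, Matrix.diagonal_transpose, hYt]
  have hRt : Rᵀ = R := by rw [hR, Matrix.transpose_add, Matrix.diagonal_transpose, hNt]
  have hE : Matrix.diagonal (b + ρ) - (Y - N) = M + R := by
    have : Matrix.diagonal (b + ρ) = Matrix.diagonal b + Matrix.diagonal ρ := by
      rw [Matrix.diagonal_add]; rfl
    rw [this, hM, hR]; abel
  have hexp : ((M + R)ᵀ * (M + R)).trace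
      = (Mᵀ * M).trace + 2 * (M * R).trace + (Rᵀ * R).trace := by
    rw [Matrix.transpose_add, hMt, hRt]
    simp only [Matrix.add_mul, Matrix.mul_add, Matrix.trace_add]
    rw [Matrix.trace_mul_comm R M]; ring
  have hRR : 0 ≤ (Rᵀ * R).trace := by
    rw [trace_transpose_mul_self]; positivity
  -- Of the four products in the cross term, `bρ` and `YN` have trace zero. The term `bN` is
  -- nonnegative, so only `ρY` can hurt.
  have hMR : (M * R).trace = ∑ j, b j * N j j - ∑ j, ρ j * Y j j := by
    rw [hM, hR]
    simp only [Matrix.sub_mul, Matrix.mul_add, Matrix.trace_add, Matrix.trace_sub, hYN,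
      Matrix.diagonal_mul_diagonal, hbρ]
    simp only [Matrix.trace, Matrix.diag_apply, Matrix.diagonal_mul, Matrix.mul_diagonal,
      Matrix.diagonal_apply_eq, Finset.sum_const_zero]
    simp only [mul_comm (Y _ _)]
    ring
  have hbN : 0 ≤ ∑ j, b j * N j j :=
    Finset.sum_nonneg fun j _ => mul_nonneg (hb j) hN.diag_nonneg
  have hρY : ∑ j, ρ j * Y j j ≤ e / lam * (Mᵀ * M).trace := by
    simp only [Matrix.trace, Matrix.diag_apply, Finset.mul_sum]
    refine Finset.sum_le_sum fun j _ => ?_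
    have hY0 : 0 ≤ Y j j := hY.diag_nonneg
    have hM0 : 0 ≤ (Mᵀ * M) j j := by
      simp only [Matrix.mul_apply, Matrix.transpose_apply]
      exact Finset.sum_nonneg fun i _ => mul_self_nonneg _
    rcases le_or_gt (ρ j) 0 with h | h
    · exact (mul_nonpos_of_nonpos_of_nonneg h hY0).trans (by positivity)
    -- Where `ρ j > 0` the entry `b j` vanishes, so row and column `j` of `M` are those of `-Y`. The
    -- spectral gap `Y² ⪰ lam Y` then bounds `Y j j` by column `j` of `M`.
    · have hbj : b j = 0 := by simpa [h.ne'] using hbρ j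
      have h1 : (Mᵀ * M) j j = (Y * Y) j j := by
        rw [hMt, Matrix.mul_apply, Matrix.mul_apply]
        refine Finset.sum_congr rfl fun k _ => ?_
        have h2 : M j k = - Y j k := by
          simp [hM, Matrix.diagonal_apply, hbj]
        have h3 : M k j = - Y k j := by
          simp only [hM, Matrix.sub_apply, Matrix.diagonal_apply]
          split_ifs with hk
          · subst hk; simp [hbj]
          · simp
        rw [h2, h3]; ring
      have h4 : lam * Y j j ≤ (Y * Y) j j := by
        have := hYY.diag_nonneg (i := j)
        simpa [Matrix.sub_apply] using this
      calc ρ j * Y j j ≤ e * Y j j := mul_le_mul_of_nonneg_right (hρ j) hY0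
        _ = e / lam * (lam * Y j j) := by field_simp
        _ ≤ e / lam * (Mᵀ * M) j j := by
          rw [h1]; exact mul_le_mul_of_nonneg_left h4 (by positivity)
  rw [hE, hexp, hMR]
  have : 2 * e / lam = 2 * (e / lam) := by ring
  rw [this]
  linarith

/-! ### Orthogonal alignment from Gram matrices -/

/-- Two configurations whose cross Gram matrix is positive semidefinite are as close as their
Gram matrices. -/
theorem gap_le_of_posSemidef {n r : ℕ} {X Y : Matrix (Fin n) (Fin r) ℝ} {lam : ℝ}
    (hX : (Xᵀ * X - lam • (1 : Matrix (Fin r) (Fin r) ℝ)).PosSemidef)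
    (hXY : (Xᵀ * Y).PosSemidef) :
    2 / 3 * lam * gap X Y ≤
      ((Y * Yᵀ - X * Xᵀ)ᵀ * (Y * Yᵀ - X * Xᵀ)).trace := by
  obtain ⟨D, rfl⟩ : ∃ D, Y = X + D := ⟨Y - X, by abel⟩
  have hK : Dᵀ * X = Xᵀ * D := by
    have h : (Xᵀ * (X + D))ᵀ = Xᵀ * (X + D) := hXY.1
    simpa [Matrix.mul_add, Matrix.transpose_add, Matrix.transpose_mul] using h
  have hgap : gap X (X + D) = (Dᵀ * D).trace := by simp [gap]
  have hM : (X + D) * (X + D)ᵀ - X * Xᵀ = D * Xᵀ + X * Dᵀ + D * Dᵀ := by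
    rw [Matrix.transpose_add]; simp only [Matrix.add_mul, Matrix.mul_add]; abel
  set G := Xᵀ * X with hG
  set K := Xᵀ * D with hKd
  set Q := Dᵀ * D with hQ
  have hQt : Qᵀ = Q := by simp [hQ, Matrix.transpose_mul]
  have hKt : Kᵀ = K := by rw [hKd, Matrix.transpose_mul, Matrix.transpose_transpose, hK]
  have hexp : ((D * Xᵀ + X * Dᵀ + D * Dᵀ)ᵀ * (D * Xᵀ + X * Dᵀ + D * Dᵀ)).trace
      = 2 * (G * Q).trace + 2 * (K * K).trace + 4 * (K * Q).trace + (Q * Q).trace := by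
    have ht : (D * Xᵀ + X * Dᵀ + D * Dᵀ)ᵀ = D * Xᵀ + X * Dᵀ + D * Dᵀ := by
      simp only [Matrix.transpose_add, Matrix.transpose_mul, Matrix.transpose_transpose]; abel
    have key : ∀ a b c d : Matrix (Fin n) (Fin r) ℝ,
        (a * bᵀ * (c * dᵀ)).trace = ((dᵀ * a) * (bᵀ * c)).trace := fun a b c d => by
      rw [← Matrix.mul_assoc, Matrix.trace_mul_comm]
      simp only [Matrix.mul_assoc]
    rw [ht]
    simp only [Matrix.add_mul _ _ (_ + _), Matrix.mul_add,
      Matrix.trace_add, key, hK, ← hG, ← hQ, ← hKd]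
    rw [Matrix.trace_mul_comm Q G, Matrix.trace_mul_comm Q K]
    ring
  have h1 : 0 ≤ ((G + K) * Q).trace := by
    have h : 0 ≤ (D * (Xᵀ * (X + D)) * Dᵀ).trace := by
      have := (hXY.mul_mul_conjTranspose_same D).trace_nonneg
      simpa using this
    rw [Matrix.trace_mul_comm, ← Matrix.mul_assoc, Matrix.trace_mul_comm, Matrix.mul_add] at h
    exact h
  have h2 : lam * Q.trace ≤ (G * Q).trace := by
    have h : 0 ≤ (D * (G - lam • (1 : Matrix (Fin r) (Fin r) ℝ)) * Dᵀ).trace := by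
      have := (hX.mul_mul_conjTranspose_same D).trace_nonneg
      simpa using this
    rw [Matrix.trace_mul_comm, ← Matrix.mul_assoc, Matrix.trace_mul_comm, Matrix.sub_mul,
      Matrix.trace_sub] at h
    simpa using h
  -- Removing this square from the expansion leaves `2 tr GQ + (2/9) tr K² + (4/3) tr KQ`. Then
  -- `(4/3)` times `h1` absorbs the `KQ` term and leaves `(2/3) tr GQ`.
  have h3 : 0 ≤ (((4 / 3 : ℝ) • K + Q)ᵀ * ((4 / 3 : ℝ) • K + Q)).trace := by
    rw [trace_transpose_mul_self]; positivity
  have h4 : 0 ≤ (Kᵀ * K).trace := by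
    rw [trace_transpose_mul_self]; positivity
  rw [Matrix.transpose_add, Matrix.transpose_smul, hKt, hQt] at h3
  rw [hKt] at h4
  simp only [Matrix.add_mul, Matrix.mul_add, Matrix.trace_add, Matrix.smul_mul, Matrix.mul_smul,
    Matrix.trace_smul, smul_eq_mul, Matrix.trace_mul_comm Q K] at h3
  rw [Matrix.add_mul, Matrix.trace_add] at h1
  rw [hM, hexp, hgap]
  linarith

open scoped MatrixOrder in
/-- Polar decomposition of an invertible real matrix. -/
theorem exists_orthogonal_mul_posSemidef {r : ℕ} {B : Matrix (Fin r) (Fin r) ℝ}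
    (hB : (B * Bᵀ).PosDef) :
    ∃ P : Matrix (Fin r) (Fin r) ℝ, Pᵀ * P = 1 ∧ (B * Pᵀ).PosSemidef := by
  obtain ⟨S, hS, hSS⟩ : ∃ S : Matrix (Fin r) (Fin r) ℝ, S.PosSemidef ∧ S * S = B * Bᵀ :=
    ⟨CFC.sqrt (B * Bᵀ), Matrix.nonneg_iff_posSemidef.1 (CFC.sqrt_nonneg _),
      CFC.sqrt_mul_sqrt_self _ hB.posSemidef.nonneg⟩
  have hSt : Sᵀ = S := hS.1
  have hdet : IsUnit B.det := by
    have := hB.det_pos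
    rw [Matrix.det_mul] at this
    exact isUnit_iff_ne_zero.2 fun h => by simp [h] at this
  have h1 : B * B⁻¹ = 1 := Matrix.mul_nonsing_inv B hdet
  have h2 : B⁻¹ * B = 1 := Matrix.nonsing_inv_mul B hdet
  -- Chosen so that `B * Pᵀ = S`; orthogonality then reduces to `S² = B Bᵀ`.
  refine ⟨S * B⁻¹ᵀ, ?_, ?_⟩
  all_goals rw [Matrix.transpose_mul, Matrix.transpose_transpose, hSt]
  · have : B⁻¹ * S * (S * B⁻¹ᵀ) = B⁻¹ * (S * S) * B⁻¹ᵀ := by simp only [Matrix.mul_assoc]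
    rw [this, hSS, ← Matrix.mul_assoc, h2, Matrix.one_mul, ← Matrix.transpose_mul, h2,
      Matrix.transpose_one]
  · rwa [← Matrix.mul_assoc, h1, Matrix.one_mul]

/-! ### Signature of the Lorentz Gram matrix -/

/-- The reverse Cauchy-Schwarz inequality on the hyperboloid. -/
theorem one_le_lorentz {m : ℕ} (x y : Hyperboloid m) : 1 ≤ lorentz x.1 y.1 := by
  obtain ⟨x, hx, hx0⟩ := x
  obtain ⟨y, hy, hy0⟩ := y
  have h := Finset.sum_mul_sq_le_sq_mul_sq Finset.univ
    (fun k : Fin m => x k.succ) (fun k => y k.succ)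
  have hx2 : ∑ k : Fin m, x k.succ ^ 2 = x 0 ^ 2 - 1 := by linarith
  have hy2 : ∑ k : Fin m, y k.succ ^ 2 = y 0 ^ 2 - 1 := by linarith
  have hxp : 0 ≤ x 0 ^ 2 - 1 := hx2 ▸ Finset.sum_nonneg fun _ _ => sq_nonneg _
  have hyp : 0 ≤ y 0 ^ 2 - 1 := hy2 ▸ Finset.sum_nonneg fun _ _ => sq_nonneg _
  have hx1 : 1 ≤ x 0 := by nlinarith
  have hy1 : 1 ≤ y 0 := by nlinarith
  rw [hx2, hy2] at h
  have h1 : 0 ≤ x 0 * y 0 - 1 := by nlinarith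
  have h2 := abs_le_of_sq_le_sq (h.trans (by nlinarith [sq_nonneg (x 0 - y 0)] :
    _ ≤ (x 0 * y 0 - 1) ^ 2)) h1
  simp only [lorentz]
  linarith [(abs_le.1 h2).2]

theorem neg_cosh_distMatrix_apply {m n : ℕ} (p : Fin n → Hyperboloid m) (i j : Fin n) :
    (-((distMatrix p).map Real.cosh)) i j = - lorentz (p i).1 (p j).1 := by
  simp [distMatrix, hypDist, Real.cosh_arcosh (one_le_lorentz _ _)]

/-- The linear combination of the points with given coefficients. -/
abbrev combination {m n : ℕ} (p : Fin n → Hyperboloid m) :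
    (Fin n → ℝ) →ₗ[ℝ] (Fin (m + 1) → ℝ) :=
  Fintype.linearCombination ℝ fun i => (p i).1

theorem dotProduct_neg_cosh_distMatrix_mulVec {m n : ℕ} (p : Fin n → Hyperboloid m)
    (v : Fin n → ℝ) : v ⬝ᵥ (-((distMatrix p).map Real.cosh)) *ᵥ v =
      ∑ k : Fin m, combination p v k.succ ^ 2 - combination p v 0 ^ 2 := by
  have key : ∀ k, combination p v k ^ 2 = ∑ i, ∑ j, v i * v j * ((p i).1 k * (p j).1 k) := by
    intro k
    rw [sq, Fintype.linearCombination_apply, Finset.sum_apply, Finset.sum_mul_sum]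
    exact Finset.sum_congr rfl fun i _ => Finset.sum_congr rfl fun j _ => by
      simp only [Pi.smul_apply, smul_eq_mul]; ring
  simp only [key, dotProduct, Matrix.mulVec, neg_cosh_distMatrix_apply, lorentz]
  rw [Finset.sum_comm, ← Finset.sum_sub_distrib]
  refine Finset.sum_congr rfl fun i _ => ?_
  rw [Finset.sum_comm, ← Finset.sum_sub_distrib, Finset.mul_sum]
  refine Finset.sum_congr rfl fun j _ => ?_
  rw [← Finset.mul_sum]
  ring

theorem finrank_ker_combination {m n r : ℕ} {p : Fin n → Hyperboloid m}
    (hp : SpansGeodesicDim p r) :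
    Module.finrank ℝ (LinearMap.ker (combination p)) + (r + 1) = n := by
  have h := LinearMap.finrank_range_add_finrank_ker (combination p)
  rw [Fintype.range_linearCombination, Module.finrank_fin_fun] at h
  rw [SpansGeodesicDim] at hp
  omega

/-- The kernel of `combination p` together with one coordinate vector, sent to a timelike point, is
a space of dimension `n - r` on which the form is at most zero. A positive `μ j` with `j ≥ r` would
make the form positive somewhere on it. -/
theorem eigenvalue_nonpos {m n r : ℕ} {p : Fin n → Hyperboloid m} (hp : SpansGeodesicDim p r)
    {V : Matrix (Fin n) (Fin n) ℝ} {μ : Fin n → ℝ} (hV : Vᵀ * V = 1) (hμ : Antitone μ)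
    (hd : -((distMatrix p).map Real.cosh) = V * Matrix.diagonal μ * Vᵀ) {j : Fin n}
    (hj : r ≤ j) : μ j ≤ 0 := by
  by_contra! hpos
  have hker := finrank_ker_combination hp
  -- Any point would serve; the eigenvalue index `j` is reused as a point index.
  set u : Fin n → ℝ := Pi.single j 1 with hu
  have hTu : combination p u = (p j).1 := by
    simp [hu, Fintype.linearCombination_apply_single]
  have hj0 : (p j).1 ≠ 0 := fun h => by
    have := (p j).2.2
    simp [h] at this
  have hinf : LinearMap.ker (combination p) ⊓ Submodule.span ℝ {u} = ⊥ := by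
    rw [Submodule.eq_bot_iff]
    rintro x ⟨hx, hx'⟩
    obtain ⟨c, rfl⟩ := Submodule.mem_span_singleton.1 hx'
    have h : combination p (c • u) = 0 := hx
    rw [map_smul, hTu, smul_eq_zero] at h
    rw [h.resolve_right hj0, zero_smul]
  have hsum := Submodule.finrank_sup_add_finrank_inf_eq
    (LinearMap.ker (combination p)) (Submodule.span ℝ {u})
  rw [hinf, finrank_bot, finrank_span_singleton (by simp [hu])] at hsum
  obtain ⟨v, hv, hv0, hvs⟩ := exists_mem_ne_zero_forall_notMem V
    (LinearMap.ker (combination p) ⊔ Submodule.span ℝ {u}) (Finset.Iic j) (by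
      rw [Fin.card_Iic]; omega)
  have h1 := dotProduct_diagonalization_mulVec V μ v
  have h2 := sum_transpose_mulVec_sq hV v
  rw [← hd, dotProduct_neg_cosh_distMatrix_mulVec] at h1
  have hpos' : 0 < ∑ i, v i ^ 2 := by
    obtain ⟨i, hi⟩ := Function.ne_iff.1 hv0
    exact Finset.sum_pos' (fun i _ => sq_nonneg _) ⟨i, Finset.mem_univ _, by
      simpa using sq_pos_of_ne_zero hi⟩
  have h5 : μ j * ∑ i, v i ^ 2 ≤ ∑ i, μ i * (Vᵀ *ᵥ v) i ^ 2 := by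
    rw [← h2, Finset.mul_sum]
    refine Finset.sum_le_sum fun i _ => ?_
    by_cases hi : i ∈ Finset.Iic j
    · exact mul_le_mul_of_nonneg_right (hμ (Finset.mem_Iic.1 hi)) (sq_nonneg _)
    · simp [hvs i hi]
  obtain ⟨x, hx, y, hy, rfl⟩ := Submodule.mem_sup.1 hv
  obtain ⟨c, rfl⟩ := Submodule.mem_span_singleton.1 hy
  rw [map_add, LinearMap.mem_ker.1 hx, zero_add, map_smul, hTu] at h1
  have h6 : ∑ k : Fin m, (c • (p j).1) k.succ ^ 2 - (c • (p j).1) 0 ^ 2 = - c ^ 2 := by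
    have := (p j).2.1
    simp only [Pi.smul_apply, smul_eq_mul, mul_pow, ← Finset.mul_sum]
    rw [← mul_sub]
    linear_combination (- c ^ 2) * this
  nlinarith [mul_pos hpos hpos', sq_nonneg c]

/-- On a complement of the kernel, of dimension `r + 1`, vanishing of the time coordinate costs at
most one dimension. The form is positive definite on what remains, so there are at least `r`
positive eigenvalues. -/
theorem eigenvalue_pos {m n r : ℕ} {p : Fin n → Hyperboloid m} (hp : SpansGeodesicDim p r)
    {V : Matrix (Fin n) (Fin n) ℝ} {μ : Fin n → ℝ} (hμ : Antitone μ)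
    (hd : -((distMatrix p).map Real.cosh) = V * Matrix.diagonal μ * Vᵀ) {j : Fin n}
    (hj : j < r) : 0 < μ j := by
  by_contra! hneg
  have hker := finrank_ker_combination hp
  obtain ⟨C, hC⟩ := Submodule.exists_isCompl (LinearMap.ker (combination p))
  have hCr := Submodule.finrank_add_eq_of_isCompl hC
  let f : (Fin n → ℝ) →ₗ[ℝ] ℝ := LinearMap.proj 0 ∘ₗ combination p
  have hf := LinearMap.finrank_range_add_finrank_ker f
  have hf1 := (LinearMap.range f).finrank_le
  have hs := Submodule.finrank_sup_add_finrank_inf_eq C (LinearMap.ker f)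
  have hs1 := (C ⊔ LinearMap.ker f).finrank_le
  rw [Module.finrank_self] at hf1
  rw [Module.finrank_fin_fun] at hCr hf hs1
  obtain ⟨v, ⟨hvC, hvf⟩, hv0, hvs⟩ := exists_mem_ne_zero_forall_notMem V
    (C ⊓ LinearMap.ker f) (Finset.Ici j) (by rw [Fin.card_Ici]; omega)
  have h1 := dotProduct_diagonalization_mulVec V μ v
  have hf0 : combination p v 0 = 0 := hvf
  rw [← hd, dotProduct_neg_cosh_distMatrix_mulVec, hf0] at h1
  have h5 : ∑ i, μ i * (Vᵀ *ᵥ v) i ^ 2 ≤ 0 := by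
    refine Finset.sum_nonpos fun i _ => ?_
    by_cases hi : i ∈ Finset.Ici j
    · exact mul_nonpos_of_nonpos_of_nonneg ((hμ (Finset.mem_Ici.1 hi)).trans hneg) (sq_nonneg _)
    · simp [hvs i hi]
  have h6 : ∑ k : Fin m, combination p v k.succ ^ 2 = 0 :=
    le_antisymm (by linarith) (Finset.sum_nonneg fun _ _ => sq_nonneg _)
  rw [Finset.sum_eq_zero_iff_of_nonneg fun _ _ => sq_nonneg _] at h6
  have h7 : combination p v = 0 := by
    funext k
    refine Fin.cases hf0 (fun k => ?_) k
    simpa using h6 k (Finset.mem_univ _)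
  have h8 : v ∈ LinearMap.ker (combination p) ⊓ C := ⟨h7, hvC⟩
  rw [hC.inf_eq_bot] at h8
  exact hv0 (by simpa using h8)

/-! ### Gram matrices of PCA configurations -/

/-- The nonnegative part of the first `r` eigenvalues, extended by zero. -/
def truncatedEigenvalues {n : ℕ} (r : ℕ) (μ : Fin n → ℝ) (j : Fin n) : ℝ :=
  if j < r then max (μ j) 0 else 0

theorem sqrt_mul_sqrt_eq_max (x : ℝ) : √x * √x = max x 0 := by
  rcases le_total 0 x with h | h
  · rw [Real.mul_self_sqrt h, max_eq_left h]
  · rw [Real.sqrt_eq_zero_of_nonpos h, max_eq_right h, zero_mul]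

theorem mul_transpose_of_pca {n r : ℕ} (h : r ≤ n) {V : Matrix (Fin n) (Fin n) ℝ} {μ : Fin n → ℝ}
    {X : Matrix (Fin n) (Fin r) ℝ}
    (hX : ∀ i j, X i j = √(μ (Fin.castLE h j)) * V i (Fin.castLE h j)) :
    X * Xᵀ = V * Matrix.diagonal (truncatedEigenvalues r μ) * Vᵀ := by
  obtain ⟨k, rfl⟩ := Nat.exists_eq_add_of_le h
  ext a c
  rw [Matrix.mul_apply, Matrix.mul_apply, Fin.sum_univ_add]
  simp only [Matrix.mul_diagonal, Matrix.transpose_apply, truncatedEigenvalues, hX]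
  rw [Finset.sum_congr rfl fun j _ => ?_, Finset.sum_eq_zero (s := Finset.univ)
    (f := fun i : Fin k => _ * _), add_zero]
  · simp
  · rw [if_pos (by simp), ← sqrt_mul_sqrt_eq_max]
    change √(μ (Fin.castLE h j)) * V a (Fin.castLE h j) *
      (√(μ (Fin.castLE h j)) * V c (Fin.castLE h j)) = V a (Fin.castLE h j) *
      (√(μ (Fin.castLE h j)) * √(μ (Fin.castLE h j))) * V c (Fin.castLE h j)
    ring

theorem transpose_mul_of_pca {n r : ℕ} (h : r ≤ n) {V : Matrix (Fin n) (Fin n) ℝ} {μ : Fin n → ℝ}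
    {X : Matrix (Fin n) (Fin r) ℝ} (hV : Vᵀ * V = 1)
    (hX : ∀ i j, X i j = √(μ (Fin.castLE h j)) * V i (Fin.castLE h j)) :
    Xᵀ * X = Matrix.diagonal fun j => max (μ (Fin.castLE h j)) 0 := by
  ext a c
  have h1 : (Vᵀ * V) (Fin.castLE h a) (Fin.castLE h c) = if a = c then 1 else 0 := by
    rw [hV, Matrix.one_apply]
    simp
  rw [Matrix.mul_apply] at h1 ⊢
  simp only [Matrix.transpose_apply, hX] at h1 ⊢
  have : ∀ i, √(μ (Fin.castLE h a)) * V i (Fin.castLE h a) *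
      (√(μ (Fin.castLE h c)) * V i (Fin.castLE h c)) =
      √(μ (Fin.castLE h a)) * √(μ (Fin.castLE h c)) *
      (V i (Fin.castLE h a) * V i (Fin.castLE h c)) := fun i => by ring
  simp only [this, ← Finset.mul_sum, h1, Matrix.diagonal_apply]
  split_ifs with hac
  · subst hac; rw [mul_one, sqrt_mul_sqrt_eq_max]
  · simp

theorem trace_conj_transpose_mul_self {n : ℕ} {V : Matrix (Fin n) (Fin n) ℝ} (hV : Vᵀ * V = 1)
    (M : Matrix (Fin n) (Fin n) ℝ) :
    ((Vᵀ * M * V)ᵀ * (Vᵀ * M * V)).trace = (Mᵀ * M).trace := by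
  have hV' : V * Vᵀ = 1 := mul_eq_one_comm.1 hV
  have : (Vᵀ * M * V)ᵀ * (Vᵀ * M * V) = Vᵀ * (Mᵀ * ((V * Vᵀ) * M)) * V := by
    simp only [Matrix.transpose_mul, Matrix.transpose_transpose, Matrix.mul_assoc]
  rw [this, hV', Matrix.one_mul, Matrix.trace_mul_comm, ← Matrix.mul_assoc, hV', Matrix.one_mul]

/-- Stability of the Gram matrix of a PCA configuration. -/
theorem IsPCA.trace_sq_sub_le {n r : ℕ} {A E : Matrix (Fin n) (Fin n) ℝ}
    {X Xhat : Matrix (Fin n) (Fin r) ℝ} {lam e : ℝ} (hlam : 0 < lam) (he : 0 ≤ e)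
    (hE : ∑ i, ∑ j, E i j ^ 2 ≤ e ^ 2)
    (hYY : (X * Xᵀ * (X * Xᵀ) - lam • (X * Xᵀ)).PosSemidef)
    (hN : (X * Xᵀ - A).PosSemidef) (hYN : (X * Xᵀ * (X * Xᵀ - A)).trace = 0)
    (hXhat : IsPCA (A + E) Xhat) :
    (1 - 2 * e / lam) *
      ((Xhat * Xhatᵀ - X * Xᵀ)ᵀ * (Xhat * Xhatᵀ - X * Xᵀ)).trace ≤ (Eᵀ * E).trace := by
  obtain ⟨h, V, μ, hV, hμ, hd, hX⟩ := hXhat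
  have hV' : V * Vᵀ = 1 := mul_eq_one_comm.1 hV
  have hW : ∀ j : Fin n, r ≤ j → μ j ≤ e := fun j hj => by
    refine eigenvalue_le_of_forall_mem_ker (X := X) (fun v hv => ?_) he hE hV hμ hd hj
    have h1 := hN.dotProduct_mulVec_nonneg v
    rw [Matrix.sub_mulVec, dotProduct_sub, ← Matrix.mulVec_mulVec, hv] at h1
    simpa using h1
  have hconj : ∀ D : Fin n → ℝ, Vᵀ * (V * Matrix.diagonal D * Vᵀ) * V = Matrix.diagonal D :=
    fun D => by
      have : Vᵀ * (V * Matrix.diagonal D * Vᵀ) * V = (Vᵀ * V) * Matrix.diagonal D * (Vᵀ * V) := by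
        simp only [Matrix.mul_assoc]
      rw [this, hV, Matrix.one_mul, Matrix.mul_one]
  have hYc : (Vᵀ * (X * Xᵀ) * V).PosSemidef := by
    have := (Matrix.posSemidef_self_mul_conjTranspose X).conjTranspose_mul_mul_same V
    simpa using this
  have hNc : (Vᵀ * (X * Xᵀ - A) * V).PosSemidef := by
    simpa using hN.conjTranspose_mul_mul_same V
  have hmul : ∀ B C : Matrix (Fin n) (Fin n) ℝ,
      (Vᵀ * B * V) * (Vᵀ * C * V) = Vᵀ * (B * C) * V := fun B C => by
    have : (Vᵀ * B * V) * (Vᵀ * C * V) = Vᵀ * (B * ((V * Vᵀ) * C)) * V := by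
      simp only [Matrix.mul_assoc]
    rw [this, hV', Matrix.one_mul]
  have hYYc : ((Vᵀ * (X * Xᵀ) * V) * (Vᵀ * (X * Xᵀ) * V) -
      lam • (Vᵀ * (X * Xᵀ) * V)).PosSemidef := by
    have := hYY.conjTranspose_mul_mul_same V
    rw [hmul]
    simpa [Matrix.mul_sub, Matrix.sub_mul] using this
  have hYNc : ((Vᵀ * (X * Xᵀ) * V) * (Vᵀ * (X * Xᵀ - A) * V)).trace = 0 := by
    rw [hmul, Matrix.trace_mul_comm, ← Matrix.mul_assoc, hV', Matrix.one_mul, hYN]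
  -- Here `ρ` is what truncation discards: the negative parts of the first `r` eigenvalues, and all
  -- later eigenvalues, which `hW` bounds by `e`.
  have key := trace_sq_diagonal_sub_le (b := truncatedEigenvalues r μ)
    (ρ := μ - truncatedEigenvalues r μ) hlam he hYc hYYc hNc hYNc
    (fun j => by unfold truncatedEigenvalues; split_ifs <;> simp)
    (fun j => by
      simp only [truncatedEigenvalues, Pi.sub_apply]
      split_ifs
      · rcases le_total 0 (μ j) with h0 | h0 <;> simp [h0]
      · simp)
    (fun j => by
      simp only [truncatedEigenvalues, Pi.sub_apply]
      split_ifs with hj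
      · linarith [le_max_left (μ j) 0]
      · linarith [hW j (not_lt.1 hj)])
  have e1 : Matrix.diagonal (truncatedEigenvalues r μ) - Vᵀ * (X * Xᵀ) * V =
      Vᵀ * (Xhat * Xhatᵀ - X * Xᵀ) * V := by
    rw [mul_transpose_of_pca h hX, Matrix.mul_sub, Matrix.sub_mul, hconj]
  have e2 : Matrix.diagonal (truncatedEigenvalues r μ + (μ - truncatedEigenvalues r μ)) -
      (Vᵀ * (X * Xᵀ) * V - Vᵀ * (X * Xᵀ - A) * V) = Vᵀ * E * V := by
    rw [add_sub_cancel, ← hconj μ, ← hd]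
    simp only [Matrix.mul_sub, Matrix.sub_mul, Matrix.mul_add, Matrix.add_mul]
    abel
  rwa [e1, e2, trace_conj_transpose_mul_self hV, trace_conj_transpose_mul_self hV] at key

/-! ### Aligned gap and Poincaré projection -/

theorem gap_eq_sum {n r : ℕ} (X Y : Matrix (Fin n) (Fin r) ℝ) :
    gap X Y = ∑ i, ∑ j, (X i j - Y i j) ^ 2 :=
  trace_transpose_mul_self (X - Y)

theorem alignedGap_le {n r : ℕ} (X Y : Matrix (Fin n) (Fin r) ℝ) {P : Matrix (Fin r) (Fin r) ℝ}
    (hP : Pᵀ * P = 1) : alignedGap X Y ≤ gap X (Y * Pᵀ) := by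
  refine csInf_le ⟨0, ?_⟩ ⟨P, hP, rfl⟩
  rintro d ⟨P, -, rfl⟩
  rw [gap_eq_sum]
  positivity

theorem sum_sq_row_mul_orthogonal {n r : ℕ} (X : Matrix (Fin n) (Fin r) ℝ)
    {P : Matrix (Fin r) (Fin r) ℝ} (hP : Pᵀ * P = 1) (i : Fin n) :
    ∑ k, (X * Pᵀ) i k ^ 2 = ∑ k, X i k ^ 2 := by
  have h : ∀ Y : Matrix (Fin n) (Fin r) ℝ, ∑ k, Y i k ^ 2 = (Y * Yᵀ) i i := fun Y => by
    rw [Matrix.mul_apply]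
    exact Finset.sum_congr rfl fun k _ => by rw [Matrix.transpose_apply, sq]
  rw [h, h, Matrix.transpose_mul, Matrix.transpose_transpose, Matrix.mul_assoc,
    ← Matrix.mul_assoc Pᵀ, hP, Matrix.one_mul]

theorem poincare_mul_orthogonal {n r : ℕ} (X : Matrix (Fin n) (Fin r) ℝ)
    {P : Matrix (Fin r) (Fin r) ℝ} (hP : Pᵀ * P = 1) :
    poincare (X * Pᵀ) = poincare X * Pᵀ := by
  ext i j
  rw [poincare, Matrix.of_apply, sum_sq_row_mul_orthogonal X hP, Matrix.mul_apply,
    Matrix.mul_apply, Finset.sum_div]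
  exact Finset.sum_congr rfl fun k _ => by rw [poincare, Matrix.of_apply]; ring

/-- The projection to the Poincaré ball does not increase distances. -/
theorem sum_sq_sub_poincare_le {r : ℕ} (x y : Fin r → ℝ) :
    ∑ k, (x k / (1 + √(1 + ∑ l, x l ^ 2)) - y k / (1 + √(1 + ∑ l, y l ^ 2))) ^ 2 ≤
      ∑ k, (x k - y k) ^ 2 := by
  have hcs := Finset.sum_mul_sq_le_sq_mul_sq Finset.univ x y
  have expand : ∀ a b : ℝ, ∑ k, (x k / a - y k / b) ^ 2 =
      (∑ k, x k ^ 2) / a ^ 2 + (∑ k, y k ^ 2) / b ^ 2 - 2 * (∑ k, x k * y k) / (a * b) :=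
    fun a b => by
      simp only [Finset.mul_sum, Finset.sum_div, ← Finset.sum_add_distrib,
        ← Finset.sum_sub_distrib]
      exact Finset.sum_congr rfl fun k _ => by ring
  have h1 := expand 1 1
  simp only [div_one, one_pow, mul_one] at h1
  rw [expand, h1]
  have hx : 0 ≤ ∑ k, x k ^ 2 := Finset.sum_nonneg fun _ _ => sq_nonneg _
  have hy : 0 ≤ ∑ k, y k ^ 2 := Finset.sum_nonneg fun _ _ => sq_nonneg _
  set p := ∑ k, x k * y k
  obtain ⟨s, hs, hs1, hsx⟩ : ∃ s, √(1 + ∑ l, x l ^ 2) = s ∧ 1 ≤ s ∧ ∑ l, x l ^ 2 = s ^ 2 - 1 :=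
    ⟨_, rfl, Real.one_le_sqrt.2 (by linarith), by rw [Real.sq_sqrt (by linarith)]; ring⟩
  obtain ⟨t, ht, ht1, hty⟩ : ∃ t, √(1 + ∑ l, y l ^ 2) = t ∧ 1 ≤ t ∧ ∑ l, y l ^ 2 = t ^ 2 - 1 :=
    ⟨_, rfl, Real.one_le_sqrt.2 (by linarith), by rw [Real.sq_sqrt (by linarith)]; ring⟩
  rw [hs, ht, hsx, hty]
  rw [hsx, hty] at hcs
  have hst : 0 ≤ s * t - 1 := by nlinarith
  have hp : p ≤ s * t - 1 := (abs_le.1 (abs_le_of_sq_le_sq (hcs.trans (by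
    nlinarith [sq_nonneg (s - t)] : _ ≤ (s * t - 1) ^ 2)) hst)).2
  have hs0 : 0 < 1 + s := by linarith
  have ht0 : 0 < 1 + t := by linarith
  have hD : 1 ≤ (1 + s) * (1 + t) := by nlinarith
  -- The right side is `2(st - 1 - p) / ((1+s)(1+t))`, while the unprojected squared distance is `(s
  -- - t)² + 2(st - 1 - p)`. Here `st - 1 - p ≥ 0` and the denominator is at least 1.
  have e1 : (s ^ 2 - 1) / (1 + s) ^ 2 + (t ^ 2 - 1) / (1 + t) ^ 2 - 2 * p / ((1 + s) * (1 + t)) =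
      ((s - 1) * (t + 1) + (t - 1) * (s + 1) - 2 * p) / ((1 + s) * (1 + t)) := by
    field_simp
    ring
  rw [e1, div_le_iff₀ (by positivity)]
  have h2 := mul_le_mul_of_nonneg_right hp (sub_nonneg.2 hD)
  have h3 : 0 ≤ (s - t) ^ 2 * ((1 + s) * (1 + t)) := by positivity
  linarith

theorem gap_poincare_le {n r : ℕ} (X Y : Matrix (Fin n) (Fin r) ℝ) :
    gap (poincare X) (poincare Y) ≤ gap X Y := by
  rw [gap_eq_sum, gap_eq_sum]
  exact Finset.sum_le_sum fun i _ => sum_sq_sub_poincare_le (X i) (Y i)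

/-! ### Perturbation of the hyperbolic cosine -/

theorem abs_le_maxNorm {n : ℕ} (A : Matrix (Fin n) (Fin n) ℝ) (i j : Fin n) :
    |A i j| ≤ maxNorm A :=
  (norm_le_pi_norm (A i) j).trans (norm_le_pi_norm (fun i => A i) i)

/-- The addition formula separates the first-order term, which must carry exactly `sinh b`, from
second-order terms that only feed the cubic error. -/
theorem abs_cosh_add_sub_cosh_le {h δ b d : ℝ} (hb : |h| ≤ b) (hδ : |δ| ≤ d) (hd : d ≤ 1) :
    |Real.cosh (h + δ) - Real.cosh h| ≤ Real.sinh b * d + 2 * Real.cosh b * d ^ 2 := by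
  have hδ1 : |δ| ≤ 1 := hδ.trans hd
  have hsq : δ ^ 2 ≤ d ^ 2 := sq_le_sq' (by linarith [(abs_le.1 hδ).1]) (abs_le.1 hδ).2
  have h1 := abs_le.1 (Real.abs_exp_sub_one_sub_id_le hδ1)
  have h2 := abs_le.1 (Real.abs_exp_sub_one_sub_id_le (x := -δ) (by rwa [abs_neg]))
  rw [neg_sq] at h2
  have hc : |Real.cosh δ - 1| ≤ d ^ 2 := by
    rw [Real.cosh_eq, abs_le]; constructor <;> linarith
  have hs : |Real.sinh δ| ≤ d + d ^ 2 := by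
    have h3 := abs_le.1 hδ
    rw [Real.sinh_eq, abs_le]; constructor <;> linarith
  have hb0 : 0 ≤ b := (abs_nonneg h).trans hb
  have hch : |Real.cosh h| ≤ Real.cosh b := by
    rw [abs_of_pos (Real.cosh_pos h), Real.cosh_le_cosh, abs_of_nonneg hb0]; exact hb
  have hsh : |Real.sinh h| ≤ Real.sinh b := by
    rw [Real.abs_sinh, Real.sinh_le_sinh]; exact hb
  have hsc : Real.sinh b ≤ Real.cosh b := (Real.sinh_lt_cosh b).le
  have e1 : Real.cosh (h + δ) - Real.cosh h =
      Real.cosh h * (Real.cosh δ - 1) + Real.sinh h * Real.sinh δ := by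
    rw [Real.cosh_add]; ring
  rw [e1]
  calc _ ≤ |Real.cosh h| * |Real.cosh δ - 1| + |Real.sinh h| * |Real.sinh δ| := by
        rw [← abs_mul, ← abs_mul]; exact abs_add_le _ _
    _ ≤ Real.cosh b * d ^ 2 + Real.sinh b * (d + d ^ 2) := by
        have : 0 ≤ Real.sinh b := (abs_nonneg _).trans hsh
        gcongr
    _ ≤ _ := by nlinarith [mul_le_mul_of_nonneg_right hsc (sq_nonneg d)]

theorem sum_sq_cosh_sub_le {n : ℕ} (H Δ : Matrix (Fin n) (Fin n) ℝ) (hΔ : maxNorm Δ ≤ 1) :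
    ∑ i, ∑ j, (-((H + Δ).map Real.cosh) - -(H.map Real.cosh)) i j ^ 2 ≤
      (n * (Real.sinh (maxNorm H) * maxNorm Δ
        + 2 * Real.cosh (maxNorm H) * maxNorm Δ ^ 2)) ^ 2 := by
  set B := Real.sinh (maxNorm H) * maxNorm Δ + 2 * Real.cosh (maxNorm H) * maxNorm Δ ^ 2
  have h : ∀ i j, (-((H + Δ).map Real.cosh) - -(H.map Real.cosh)) i j ^ 2 ≤ B ^ 2 := fun i j => by
    have h1 := abs_cosh_add_sub_cosh_le (abs_le_maxNorm H i j) (abs_le_maxNorm Δ i j) hΔ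
    have e : (-((H + Δ).map Real.cosh) - -(H.map Real.cosh)) i j =
        -(Real.cosh (H i j + Δ i j) - Real.cosh (H i j)) := by
      simp only [Matrix.sub_apply, Matrix.neg_apply, Matrix.map_apply, Matrix.add_apply]; ring
    rw [e, neg_sq, ← sq_abs]
    exact pow_le_pow_left₀ (abs_nonneg _) h1 2
  calc _ ≤ ∑ _i : Fin n, ∑ _j : Fin n, B ^ 2 :=
        Finset.sum_le_sum fun i _ => Finset.sum_le_sum fun j _ => h i j
    _ = _ := by simp; ring

/-! ### Alignment and spectral data of h-MDS -/

/-- An orthogonal alignment of two configurations with nearby Gram matrices. -/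
theorem exists_orthogonal_gap_le {n r : ℕ} {X Y : Matrix (Fin n) (Fin r) ℝ} {g : Fin r → ℝ}
    {lam m : ℝ} (hX : Xᵀ * X = Matrix.diagonal g) (hg : ∀ j, lam ≤ g j) (hm : 0 ≤ m)
    (hml : m < lam)
    (hM : ((Y * Yᵀ - X * Xᵀ)ᵀ * (Y * Yᵀ - X * Xᵀ)).trace ≤ m ^ 2) :
    ∃ P : Matrix (Fin r) (Fin r) ℝ, Pᵀ * P = 1 ∧ 2 / 3 * lam * gap X (Y * Pᵀ) ≤
      ((Y * Yᵀ - X * Xᵀ)ᵀ * (Y * Yᵀ - X * Xᵀ)).trace := by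
  have hlam : 0 < lam := hm.trans_lt hml
  have hB : (Xᵀ * Y * (Xᵀ * Y)ᵀ).PosDef := by
    refine Matrix.PosDef.of_dotProduct_mulVec_pos ?_ fun {v} hv => ?_
    · have := Matrix.isHermitian_mul_conjTranspose_self (Xᵀ * Y)
      simpa using this
    · rw [trace_transpose_mul_self] at hM
      have h1 := (abs_le.1 (abs_dotProduct_mulVec_le hm hM (X *ᵥ v))).1
      -- The last summand is at least `-m · diag g` as a form, and `g (g - m) > 0` because `m < lam
      -- ≤ g`; hence the cross Gram matrix is invertible.
      have h2 : Xᵀ * Y * (Xᵀ * Y)ᵀ = Matrix.diagonal (fun j => g j * g j)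
          + Xᵀ * (Y * Yᵀ - X * Xᵀ) * X := by
        have : Xᵀ * (X * Xᵀ) * X = Xᵀ * X * (Xᵀ * X) := by simp only [Matrix.mul_assoc]
        rw [Matrix.mul_sub, Matrix.sub_mul, this, hX, Matrix.diagonal_mul_diagonal,
          Matrix.transpose_mul, Matrix.transpose_transpose]
        simp only [Matrix.mul_assoc]
        abel
      have h3 : v ⬝ᵥ (Xᵀ * (Y * Yᵀ - X * Xᵀ) * X) *ᵥ v =
          (X *ᵥ v) ⬝ᵥ (Y * Yᵀ - X * Xᵀ) *ᵥ (X *ᵥ v) := by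
        rw [← Matrix.mulVec_mulVec, ← Matrix.mulVec_mulVec, Matrix.dotProduct_mulVec,
          Matrix.vecMul_transpose]
      have h4 : ∑ i, (X *ᵥ v) i ^ 2 = ∑ j, g j * v j ^ 2 := by
        have : (X *ᵥ v) ⬝ᵥ (X *ᵥ v) = v ⬝ᵥ Matrix.diagonal g *ᵥ v := by
          rw [← hX, ← Matrix.mulVec_mulVec, Matrix.dotProduct_mulVec v, Matrix.vecMul_transpose]
        simp only [dotProduct, Matrix.mulVec_diagonal] at this
        calc _ = _ := Finset.sum_congr rfl fun i _ => sq _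
          _ = _ := this
          _ = _ := Finset.sum_congr rfl fun i _ => by ring
      have h5 : v ⬝ᵥ Matrix.diagonal (fun j => g j * g j) *ᵥ v = ∑ j, g j * g j * v j ^ 2 := by
        simp only [dotProduct, Matrix.mulVec_diagonal]
        exact Finset.sum_congr rfl fun i _ => by ring
      have h6 : 0 < ∑ j, g j * (g j - m) * v j ^ 2 := by
        have hpos : ∀ j, 0 < g j * (g j - m) := fun j =>
          mul_pos (hlam.trans_le (hg j)) (sub_pos.2 (hml.trans_le (hg j)))
        obtain ⟨j, hj⟩ := Function.ne_iff.1 hv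
        exact Finset.sum_pos' (fun i _ => mul_nonneg (hpos i).le (sq_nonneg _))
          ⟨j, Finset.mem_univ _, mul_pos (hpos j) (sq_pos_of_ne_zero (by simpa using hj))⟩
      have h7 : ∑ j, g j * (g j - m) * v j ^ 2 =
          ∑ j, g j * g j * v j ^ 2 - m * ∑ j, g j * v j ^ 2 := by
        rw [Finset.mul_sum, ← Finset.sum_sub_distrib]
        exact Finset.sum_congr rfl fun i _ => by ring
      rw [star_trivial, h2, Matrix.add_mulVec, dotProduct_add, h3, h5]
      rw [h4] at h1
      linarith
  obtain ⟨P, hP, hS⟩ := exists_orthogonal_mul_posSemidef hB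
  refine ⟨P, hP, ?_⟩
  have hG : (Xᵀ * X - lam • (1 : Matrix (Fin r) (Fin r) ℝ)).PosSemidef := by
    rw [hX, Matrix.smul_one_eq_diagonal, Matrix.diagonal_sub]
    exact Matrix.PosSemidef.diagonal fun j => by simpa using hg j
  have := gap_le_of_posSemidef (Y := Y * Pᵀ) hG (by rwa [← Matrix.mul_assoc])
  rwa [Matrix.transpose_mul, Matrix.transpose_transpose, Matrix.mul_assoc Y,
    ← Matrix.mul_assoc Pᵀ, hP, Matrix.one_mul] at this

theorem IsMinNonzeroEigenvalue.pos {n r : ℕ} {X : Matrix (Fin n) (Fin r) ℝ} {lam : ℝ}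
    (h : IsMinNonzeroEigenvalue (X * Xᵀ) lam) : 0 < lam := by
  obtain ⟨⟨h0, he⟩, -⟩ := h
  obtain ⟨v, hv⟩ := he.exists_hasEigenvector
  refine lt_of_le_of_ne ?_ h0.symm
  have h1 : 0 ≤ v ⬝ᵥ (X * Xᵀ) *ᵥ v := by
    have := (Matrix.posSemidef_self_mul_conjTranspose X).dotProduct_mulVec_nonneg v
    simpa using this
  have h2 : (X * Xᵀ) *ᵥ v = lam • v := by simpa using hv.apply_eq_smul
  rw [h2, dotProduct_smul, smul_eq_mul] at h1
  exact nonneg_of_mul_nonneg_left h1 (by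
    have := Matrix.dotProduct_star_self_pos_iff (v := v)
    simpa using this.2 hv.2)

/-- The spectral data of an h-MDS configuration of the exact distance matrix. -/
theorem IsHMDS.spectrum {m n r : ℕ} {p : Fin n → Hyperboloid m} (hp : SpansGeodesicDim p r)
    {X : Matrix (Fin n) (Fin r) ℝ} (hX : IsHMDS (distMatrix p) X) {lam : ℝ}
    (hlam : IsMinNonzeroEigenvalue (X * Xᵀ) lam) :
    (∃ g : Fin r → ℝ, Xᵀ * X = Matrix.diagonal g ∧ ∀ j, lam ≤ g j) ∧
    (X * Xᵀ * (X * Xᵀ) - lam • (X * Xᵀ)).PosSemidef ∧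
    (X * Xᵀ - -((distMatrix p).map Real.cosh)).PosSemidef ∧
    (X * Xᵀ * (X * Xᵀ - -((distMatrix p).map Real.cosh))).trace = 0 := by
  obtain ⟨h, V, μ, hV, hμ, hd, hXV⟩ := hX
  have hXX := mul_transpose_of_pca h hXV
  set b := truncatedEigenvalues r μ with hb
  have hlt : ∀ j : Fin n, j < r → b j = μ j := fun j hj => by
    rw [hb, truncatedEigenvalues, if_pos hj, max_eq_left (eigenvalue_pos hp hμ hd hj).le]
  have hge : ∀ j : Fin n, ¬ j < r → b j = 0 := fun j hj => by
    rw [hb, truncatedEigenvalues, if_neg hj]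
  have hle : ∀ j : Fin n, j < r → lam ≤ μ j := fun j hj => by
    refine hlam.2 ⟨(eigenvalue_pos hp hμ hd hj).ne', ?_⟩
    refine Module.End.hasEigenvalue_of_hasEigenvector (x := V *ᵥ Pi.single j 1)
      (Module.End.hasEigenvector_iff.2 ⟨Module.End.mem_eigenspace_iff.2 ?_, fun h0 => ?_⟩)
    · rw [Matrix.toLin'_apply, hXX, Matrix.mulVec_mulVec, Matrix.mul_assoc, hV, Matrix.mul_one,
        ← Matrix.mulVec_mulVec, ← Matrix.mulVec_smul]
      congr 1
      rw [Matrix.diagonal_mulVec_single, hlt j hj, ← Pi.single_smul]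
      simp
    · have := congrArg (Vᵀ *ᵥ ·) h0
      simp only [Matrix.mulVec_mulVec, hV, Matrix.one_mulVec, Matrix.mulVec_zero] at this
      simp at this
  have hmul : ∀ D D' : Fin n → ℝ, V * Matrix.diagonal D * Vᵀ * (V * Matrix.diagonal D' * Vᵀ) =
      V * Matrix.diagonal (fun j => D j * D' j) * Vᵀ := fun D D' => by
    have : V * Matrix.diagonal D * Vᵀ * (V * Matrix.diagonal D' * Vᵀ) =
        V * (Matrix.diagonal D * ((Vᵀ * V) * Matrix.diagonal D')) * Vᵀ := by
      simp only [Matrix.mul_assoc]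
    rw [this, hV, Matrix.one_mul, Matrix.diagonal_mul_diagonal]
  have hsub : ∀ D D' : Fin n → ℝ, V * Matrix.diagonal D * Vᵀ - V * Matrix.diagonal D' * Vᵀ =
      V * Matrix.diagonal (fun j => D j - D' j) * Vᵀ := fun D D' => by
    rw [← Matrix.sub_mul, ← Matrix.mul_sub, Matrix.diagonal_sub]
  have hpsd : ∀ D : Fin n → ℝ, (∀ j, 0 ≤ D j) → (V * Matrix.diagonal D * Vᵀ).PosSemidef :=
    fun D hD => by
      have := (Matrix.PosSemidef.diagonal (d := D) hD).mul_mul_conjTranspose_same V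
      simpa using this
  refine ⟨⟨_, transpose_mul_of_pca h hV hXV, fun j =>
    (hle _ (by simp)).trans (le_max_left _ _)⟩, ?_, ?_, ?_⟩
  · have hs : lam • (V * Matrix.diagonal b * Vᵀ) = V * Matrix.diagonal (lam • b) * Vᵀ := by
      rw [Matrix.diagonal_smul, Matrix.mul_smul, Matrix.smul_mul]
    rw [hXX, hs, hmul, hsub]
    refine hpsd _ fun j => ?_
    by_cases hj : (j : ℕ) < r
    · have h1 := hle j hj
      have h2 := eigenvalue_pos hp hμ hd hj
      rw [Pi.smul_apply, smul_eq_mul, hlt j hj, ← sub_mul]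
      exact mul_nonneg (sub_nonneg.2 h1) h2.le
    · simp [hge j hj]
  · rw [hXX, hd, hsub]
    refine hpsd _ fun j => ?_
    by_cases hj : (j : ℕ) < r
    · rw [hlt j hj, sub_self]
    · rw [hge j hj, zero_sub, neg_nonneg]
      exact eigenvalue_nonpos hp hV hμ hd (not_lt.1 hj)
  · rw [hXX, hd, hsub, hmul]
    have : (fun j => b j * (b j - μ j)) = 0 := by
      funext j
      by_cases hj : (j : ℕ) < r
      · simp [hlt j hj]
      · simp [hge j hj]
    rw [this]
    simp

/-- The smallest nonzero eigenvalue does not depend on the h-MDS configuration. -/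
theorem IsHMDS.minNonzeroEigenvalue_unique {m n r : ℕ} {p : Fin n → Hyperboloid m}
    (hp : SpansGeodesicDim p r) {X X' : Matrix (Fin n) (Fin r) ℝ}
    (hX : IsHMDS (distMatrix p) X) (hX' : IsHMDS (distMatrix p) X') {lam lam' : ℝ}
    (hlam : IsMinNonzeroEigenvalue (X * Xᵀ) lam)
    (hlam' : IsMinNonzeroEigenvalue (X' * X'ᵀ) lam') : lam = lam' := by
  obtain ⟨-, hYY, hN, hYN⟩ := hX.spectrum hp hlam
  -- Stability with zero perturbation forces the two Gram matrices to coincide.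
  have h := IsPCA.trace_sq_sub_le (E := 0) (Xhat := X') hlam.pos le_rfl (by simp) hYY hN hYN
    (by rw [add_zero]; exact hX')
  rw [trace_transpose_mul_self] at h
  simp only [mul_zero, zero_div, sub_zero, one_mul, Matrix.trace_zero] at h
  have heq : X' * X'ᵀ = X * Xᵀ := by
    have h0 := le_antisymm h (by positivity)
    ext i j
    rw [Finset.sum_eq_zero_iff_of_nonneg fun _ _ => by positivity] at h0
    have h1 := h0 i (Finset.mem_univ _)
    rw [Finset.sum_eq_zero_iff_of_nonneg fun _ _ => by positivity] at h1
    have h2 := h1 j (Finset.mem_univ _)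
    rw [sq_eq_zero_iff, Matrix.sub_apply, sub_eq_zero] at h2
    exact h2
  rw [heq] at hlam'
  exact hlam.unique hlam'

end HMDS

/-! ### The second-order bound -/

theorem mainTheorem3 (m n r : ℕ) (p : Fin n → HMDS.Hyperboloid m)
    (hp : HMDS.SpansGeodesicDim p r) :
    ∃ C ε : ℝ, 0 < ε ∧
      ∀ Δ : Matrix (Fin n) (Fin n) ℝ, Δ.IsSymm → HMDS.maxNorm Δ ≤ ε →
      ∀ X Xhat : Matrix (Fin n) (Fin r) ℝ,
        HMDS.IsHMDS (HMDS.distMatrix p) X →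
        HMDS.IsHMDS (HMDS.distMatrix p + Δ) Xhat →
      ∀ lam : ℝ, HMDS.IsMinNonzeroEigenvalue (X * Xᵀ) lam →
        HMDS.alignedGap X Xhat ≤
          2 * (n : ℝ) ^ 2 / lam * Real.sinh (HMDS.maxNorm (HMDS.distMatrix p)) ^ 2
            * HMDS.maxNorm Δ ^ 2 + C * HMDS.maxNorm Δ ^ 3 ∧
        HMDS.alignedGap (HMDS.poincare X) (HMDS.poincare Xhat) ≤
          2 * (n : ℝ) ^ 2 / lam * Real.sinh (HMDS.maxNorm (HMDS.distMatrix p)) ^ 2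
            * HMDS.maxNorm Δ ^ 2 + C * HMDS.maxNorm Δ ^ 3 := by

  -- `C` and `ε` must be fixed before `X` and `lam`, so they are built from a reference eigenvalue
  -- `lam₀`, later identified with `lam`. If none exists, the claim is vacuous.
  by_cases hex : ∃ (X₀ : Matrix (Fin n) (Fin r) ℝ) (lam₀ : ℝ),
      HMDS.IsHMDS (HMDS.distMatrix p) X₀ ∧ HMDS.IsMinNonzeroEigenvalue (X₀ * X₀ᵀ) lam₀
  swap
  · exact ⟨0, 1, one_pos, fun _ _ _ X _ hX _ lam hlam => (hex ⟨X, lam, hX, hlam⟩).elim⟩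
  obtain ⟨X₀, lam₀, hX₀, hlam₀⟩ := hex
  have hpos := hlam₀.pos
  set H := HMDS.distMatrix p
  set s := Real.sinh (HMDS.maxNorm H)
  set κ := 2 * Real.cosh (HMDS.maxNorm H) with hκ
  have hs : 0 ≤ s := Real.sinh_nonneg_iff.2 (norm_nonneg _)
  have hκ0 : 0 ≤ κ := by have := Real.cosh_pos (HMDS.maxNorm H); positivity
  -- `C` collects the `d³` and `d⁴` terms of `(s d + κ d²)²`, using `d ≤ 1`. The second bound in `ε`
  -- ensures `e ≤ lam / 8`; the `+ 1` keeps its denominator positive.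
  refine ⟨2 * (n : ℝ) ^ 2 / lam₀ * (2 * s * κ + κ ^ 2), min 1 (lam₀ / (8 * (n * (s + κ) + 1))),
    by positivity, ?_⟩
  intro Δ _ hΔ X Xhat hX hXhat lam hlam
  obtain rfl := HMDS.IsHMDS.minNonzeroEigenvalue_unique hp hX hX₀ hlam hlam₀
  obtain ⟨⟨g, hXX, hg⟩, hYY, hN, hYN⟩ := hX.spectrum hp hlam
  have hd1 : HMDS.maxNorm Δ ≤ 1 := hΔ.trans (min_le_left _ _)
  have hd2 := hΔ.trans (min_le_right _ _)
  have hE := HMDS.sum_sq_cosh_sub_le H Δ hd1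
  have hd0 : 0 ≤ HMDS.maxNorm Δ := norm_nonneg _
  set d := HMDS.maxNorm Δ
  rw [← hκ] at hE
  set e := n * (s * d + κ * d ^ 2) with he
  have he0 : 0 ≤ e := by positivity
  have hel : e ≤ lam / 8 := by
    rw [le_div_iff₀ (by positivity)] at hd2
    have h1 : κ * d ^ 2 ≤ κ * d := by
      have : d ^ 2 ≤ d := by nlinarith
      exact mul_le_mul_of_nonneg_left this hκ0
    have h2 : e ≤ n * (s * d + κ * d) := by rw [he]; gcongr
    linarith
  have hT := HMDS.IsPCA.trace_sq_sub_le hpos he0 hE hYY hN hYN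
    (by rw [add_sub_cancel]; exact hXhat)
  rw [HMDS.trace_transpose_mul_self (-((H + Δ).map Real.cosh) - -(H.map Real.cosh))] at hT
  set T := ((Xhat * Xhatᵀ - X * Xᵀ)ᵀ * (Xhat * Xhatᵀ - X * Xᵀ)).trace with hTd
  have hT0 : 0 ≤ T := by rw [hTd, HMDS.trace_transpose_mul_self]; positivity
  have hT1 : 3 / 4 * T ≤ e ^ 2 := by
    refine le_trans (mul_le_mul_of_nonneg_right ?_ hT0) (hT.trans hE)
    have : 2 * e / lam ≤ 1 / 4 := by
      rw [div_le_iff₀ hpos]; linarith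
    linarith
  -- `m = 2e` works since `T ≤ (4/3) e² ≤ (2e)²` and `2e ≤ lam / 4`.
  obtain ⟨P, hP, hgap⟩ := HMDS.exists_orthogonal_gap_le (m := 2 * e) (Y := Xhat) hXX hg
    (by positivity) (by linarith) (by nlinarith [sq_nonneg e])
  have hbound : HMDS.gap X (Xhat * Pᵀ) ≤ 2 * (n : ℝ) ^ 2 / lam * s ^ 2 * d ^ 2 +
      2 * (n : ℝ) ^ 2 / lam * (2 * s * κ + κ ^ 2) * d ^ 3 := by
    have h1 : HMDS.gap X (Xhat * Pᵀ) ≤ 2 / lam * e ^ 2 := by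
      rw [div_mul_eq_mul_div, le_div_iff₀ hpos]
      linarith
    have h2 : e ^ 2 ≤ (n : ℝ) ^ 2 * (s ^ 2 * d ^ 2 + (2 * s * κ + κ ^ 2) * d ^ 3) := by
      rw [he, mul_pow]
      refine mul_le_mul_of_nonneg_left ?_ (sq_nonneg _)
      have : κ ^ 2 * d ^ 4 ≤ κ ^ 2 * d ^ 3 :=
        mul_le_mul_of_nonneg_left (pow_le_pow_of_le_one hd0 hd1 (by norm_num)) (sq_nonneg _)
      linarith
    calc _ ≤ 2 / lam * e ^ 2 := h1
      _ ≤ 2 / lam * ((n : ℝ) ^ 2 * (s ^ 2 * d ^ 2 + (2 * s * κ + κ ^ 2) * d ^ 3)) := by gcongr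
      _ = _ := by ring
  refine ⟨(HMDS.alignedGap_le X Xhat hP).trans hbound, ?_⟩
  refine (HMDS.alignedGap_le _ _ hP).trans (le_trans ?_ hbound)
  rw [← HMDS.poincare_mul_orthogonal _ hP]
  exact HMDS.gap_poincare_le _ _
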